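/- Let $R$ be a pseudo-valuation domain with maximal ideal $M$ and quotient field $Q$, that is, an integral domain such that for every prime ideal $P$ of $R$ and all $x,y\in Q$ with $xy\in P$, one has $x\in P$ or $y\in P$. Let $V$ be its canonically associated valuation overring: the valuation domain with $R\subseteq V\subseteq Q$ such that every prime ideal of $R$ is also a prime ideal of $V$ and $R$ and $V$ are local with the same maximal ideal $M$. Let $R'$ be the integral closure of $R$ in $Q$ (so $R\subseteq R'\subseteq V$), and put $K=R/M$, $L=R'/M$ and $F=V/M$, so that $K\subseteq L\subseteq F$. Terminology ($\subset$ denotes proper inclusion). A domain $A$ is valuative if for each $x$ in its quotient field there is no ring strictly between $A$ and $A[x]$ or there is no ring strictly between $A$ and $A[x^{-1}]$ (for $x=0$ there is no condition). A proper subring $A$ of a domain $T$ is a maximal non valuative subring of $T$ if $A$ is not valuative but every subring $S$ of $T$ with $A\subset S$ is valuative; a domain is a maximal non valuative domain if it is a maximal non valuative subring of its quotient field. An extension $A\subset B$ is pointwise minimal if for every $x\in B\setminus A$ there is no ring strictly between $A$ and $A[x]$. Then the following are equivalent: (i) $R$ is a maximal non valuative subring of $V$; (ii) $R$ is a maximal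 non valuative domain; (iii) $R'=V$, $R\subset R'$ is a proper extension which is not pointwise minimal, and for each ring $S$ with $R\subset S\subseteq R'$, either $S=R'$ or $S\subset R'$ is a pointwise minimal extension; (iv) $L=F$, $K\subset L$ is a proper extension which is not pointwise minimal, and for each ring $S$ with $K\subset S\subseteq L$, either $S=L$ or $S\subset L$ is a pointwise minimal extension. -/

import Mathlib

/-- The ring `A[x]` generated by a subring `A` of a commutative ring `T` and an element `x`. -/
def adjoinElem {T : Type*} [CommRing T] (A : Subring T) (x : T) : Subring T :=
  (Algebra.adjoin A {x}).toSubring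

/-- `A ⊂ B` is a pointwise minimal extension: the inclusion is proper, and for every
`x ∈ B \ A` the extension `A ⊂ A[x]` is minimal (proper, with no ring strictly between; this
is the covering relation `⋖` in the lattice of subrings). -/
def IsPointwiseMinimalExt {T : Type*} [CommRing T] (A B : Subring T) : Prop :=
  A < B ∧ ∀ x ∈ B, x ∉ A → A ⋖ adjoinElem A x

/-- The quotient field of a subring `A` of a field `Q`, realised inside `Q`. -/
def quotField {Q : Type*} [Field Q] (A : Subring Q) : Subfield Q :=
  Subfield.closure (A : Set Q)

/-- `A` is a valuative domain: for every `x` in the quotient field of `A`, there is no ring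
strictly between `A` and `A[x]`, or no ring strictly between `A` and `A[x⁻¹]`.
(`A ⩿ B` means `A ≤ B` with nothing strictly between; `A = B` is allowed. For `x = 0`
one has `A[x] = A`, so the value of `0⁻¹` plays no role.) -/
def IsValuativeDomain {Q : Type*} [Field Q] (A : Subring Q) : Prop :=
  ∀ x ∈ quotField A, A ⩿ adjoinElem A x ∨ A ⩿ adjoinElem A x⁻¹

/-- `A` is a maximal non valuative subring of `B`. -/
def IsMaximalNonValuativeSubring {Q : Type*} [Field Q] (A B : Subring Q) : Prop :=
  A < B ∧ ¬ IsValuativeDomain A ∧ ∀ S : Subring Q, A < S → S ≤ B → IsValuativeDomain S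

/-- `A` is a maximal non valuative domain: a maximal non valuative subring of its quotient
field. -/
def IsMaximalNonValuativeDomain {Q : Type*} [Field Q] (A : Subring Q) : Prop :=
  IsMaximalNonValuativeSubring A (quotField A).toSubring

/-- `A` is a pseudo-valuation domain: whenever `P` is a prime ideal of `A` and `x`, `y` are
elements of the quotient field of `A` with `x * y ∈ P`, then `x ∈ P` or `y ∈ P`. -/
def IsPseudoValuationDomain {Q : Type*} [Field Q] (A : Subring Q) : Prop :=
  ∀ P : Ideal A, P.IsPrime → ∀ x ∈ quotField A, ∀ y ∈ quotField A,
    x * y ∈ (Subtype.val '' (P : Set A) : Set Q) →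
      x ∈ (Subtype.val '' (P : Set A) : Set Q) ∨ y ∈ (Subtype.val '' (P : Set A) : Set Q)

/-- The valuation ring `V` of `Q` is the valuation overring associated with `R`: it contains `R`,
every prime ideal of `R` is (as a subset of `Q`) a prime ideal of `V`, and `R` and `V` are local
with the same maximal ideal. (Every `ValuationSubring` is local.) -/
structure IsAssociatedValuationOverring {Q : Type*} [Field Q] (R : Subring Q)
    (V : ValuationSubring Q) : Prop where
  le : R ≤ V.toSubring
  prime : ∀ P : Ideal R, P.IsPrime →
    ∃ P' : Ideal V, P'.IsPrime ∧
      (Subtype.val '' (P' : Set V) : Set Q) = Subtype.val '' (P : Set R)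
  [isLocalRing : IsLocalRing R]
  maximalIdeal_eq :
    (Subtype.val '' (IsLocalRing.maximalIdeal R : Set R) : Set Q) =
      Subtype.val '' (IsLocalRing.maximalIdeal V : Set V)

/-- The integral closure of `R` in the field `Q`, as a subring of `Q`. -/
def integralClosureIn {Q : Type*} [Field Q] (R : Subring Q) : Subring Q :=
  (integralClosure R Q).toSubring

/-- For a ring `A` with `M ⊆ A ⊆ V`, where `M` is the maximal ideal of `V`, this is the residue
ring `A / M`, viewed as a subring of the residue field `V / M`, that is, the image of `A` under
`V → V / M`. -/
def residueSubring {Q : Type*} [Field Q] (V : ValuationSubring Q) (A : Subring Q) :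
    Subring (IsLocalRing.ResidueField V) :=
  (A.comap V.subtype).map (IsLocalRing.residue V)

open Polynomial IsLocalRing

/-! Everything is decided in the residue field `F = V/M`. Rings between `R` and `V` contain `M`, so
they correspond to rings between `K` and `F`, compatibly with inclusion, adjunction of an element
and integrality; this gives (iii) ⇔ (iv). If `x` or `x⁻¹` lies in `M`, the valuative condition at
`x` is trivial, so it only needs testing on residues (`isValuativeDomain_iff_residueSubring`).

For (i) ⇔ (iv), `K` is a field. If all rings properly above `K` are valuative in `F`, then `F` is
algebraic over `K`, as `K[t ^ 4]` is a counterexample for transcendental `t`. Once `F` is algebraic,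
`S[x⁻¹] = S[x]` for `S ⊇ K`, so the valuative condition says that `S = F` or `S ⊂ F` is pointwise
minimal (`isValuativeIn_iff_of_forall_isIntegral`).

For (i) ⇔ (ii), a ring containing `M` is comparable with `V`, and overrings of `V` are valuation
rings. -/

lemma adjoinElem_le_iff {T : Type*} [CommRing T] {A B : Subring T} {x : T} :
    adjoinElem A x ≤ B ↔ A ≤ B ∧ x ∈ B := by
  constructor
  · intro h
    exact ⟨fun a ha => h ((Algebra.adjoin A {x}).algebraMap_mem ⟨a, ha⟩),
      h (Algebra.subset_adjoin rfl)⟩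
  · rintro ⟨hA, hx⟩ y hy
    refine Algebra.adjoin_induction (p := fun z _ => z ∈ B) ?_ ?_ ?_ ?_ hy
    · rintro z rfl
      exact hx
    · exact fun r => hA r.2
    · exact fun _ _ _ _ => B.add_mem
    · exact fun _ _ _ _ => B.mul_mem

lemma le_adjoinElem {T : Type*} [CommRing T] (A : Subring T) (x : T) : A ≤ adjoinElem A x :=
  (adjoinElem_le_iff.1 le_rfl).1

lemma mem_adjoinElem {T : Type*} [CommRing T] (A : Subring T) (x : T) : x ∈ adjoinElem A x :=
  (adjoinElem_le_iff.1 le_rfl).2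

lemma adjoinElem_eq_self {T : Type*} [CommRing T] {A : Subring T} {x : T} (hx : x ∈ A) :
    adjoinElem A x = A :=
  le_antisymm (adjoinElem_le_iff.2 ⟨le_rfl, hx⟩) (le_adjoinElem A x)

lemma wcovBy_adjoinElem_of_mem {T : Type*} [CommRing T] {A : Subring T} {x : T} (hx : x ∈ A) :
    A ⩿ adjoinElem A x :=
  (adjoinElem_eq_self hx).symm ▸ WCovBy.refl A

lemma mem_adjoinElem_iff {T : Type*} [CommRing T] {A : Subring T} {x y : T} :
    y ∈ adjoinElem A x ↔ ∃ p : A[X], aeval x p = y := by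
  change y ∈ Algebra.adjoin A {x} ↔ _
  rw [Algebra.adjoin_singleton_eq_range_aeval]
  rfl

/-! ### The valuative condition inside a field -/

section Field

variable {F : Type*} [Field F]

/-- `A` satisfies the valuative condition at every element of the ambient field `F`. -/
def IsValuativeIn (A : Subring F) : Prop :=
  ∀ x : F, A ⩿ adjoinElem A x ∨ A ⩿ adjoinElem A x⁻¹

/-- The ring `K[t ^ 4]` fails the valuative condition at a transcendental element `t`, because
`K[t ^ 2]` is strictly between `K[t ^ 4]` and both `K[t]` and `K[t ^ 4, t⁻¹]`. -/
lemma not_isValuativeIn_of_transcendental {K : Subring F} {t : F} (ht : Transcendental K t) :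
    ¬ IsValuativeIn (adjoinElem K (t ^ 4)) := by
  have inj : Function.Injective (aeval (R := K) t) := transcendental_iff_injective.1 ht
  have h0 : t ≠ 0 := by
    rintro rfl
    exact ht isAlgebraic_zero
  -- By transcendence, compare degrees: a polynomial in `X ^ n` has degree divisible by `n`.
  have key : ∀ (n m : ℕ), 0 < n → t ^ m ∈ adjoinElem K (t ^ n) → n ∣ m := by
    intro n m hn h
    obtain ⟨p, hp⟩ := mem_adjoinElem_iff.1 h
    have : expand K n p = X ^ m := by
      apply inj
      rw [expand_aeval, hp]
      simp
    have h2 := congrArg natDegree this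
    rw [natDegree_expand, natDegree_X_pow] at h2
    exact ⟨_, by rw [← h2, mul_comm]⟩
  have h42 : t ^ 2 ∉ adjoinElem K (t ^ 4) := fun h => by
    have := key 4 2 (by norm_num) h
    omega
  have h21 : t ∉ adjoinElem K (t ^ 2) := fun h => by
    have := key 2 1 (by norm_num) (by simpa using h)
    omega
  have hinv : t⁻¹ ∉ adjoinElem K (t ^ 2) := fun h => by
    refine h21 ?_
    have h3 := mul_mem h (mem_adjoinElem K (t ^ 2))
    have h4 : t⁻¹ * t ^ 2 = t := by field_simp
    rwa [h4] at h3
  have hlt : adjoinElem K (t ^ 4) < adjoinElem K (t ^ 2) := by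
    refine lt_of_le_of_ne (adjoinElem_le_iff.2 ⟨le_adjoinElem _ _, ?_⟩) ?_
    · have := pow_mem (mem_adjoinElem K (t ^ 2)) 2
      rwa [← pow_mul] at this
    · exact fun h => h42 (h ▸ mem_adjoinElem K (t ^ 2))
  have fin : ∀ y, y ∉ adjoinElem K (t ^ 2) → t ^ 2 ∈ adjoinElem (adjoinElem K (t ^ 4)) y →
      ¬ adjoinElem K (t ^ 4) ⩿ adjoinElem (adjoinElem K (t ^ 4)) y := by
    intro y hy h2 hc
    refine hc.2 hlt (lt_of_le_of_ne (adjoinElem_le_iff.2 ⟨?_, h2⟩) ?_)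
    · exact (le_adjoinElem _ _).trans (le_adjoinElem _ _)
    · exact fun h => hy (h ▸ mem_adjoinElem _ y)
  intro hv
  rcases hv t with h | h
  · exact fin t h21 (pow_mem (mem_adjoinElem _ _) 2) h
  · refine fin t⁻¹ hinv ?_ h
    have h4 := le_adjoinElem (adjoinElem K (t ^ 4)) t⁻¹ (mem_adjoinElem K (t ^ 4))
    have := mul_mem h4 (pow_mem (mem_adjoinElem (adjoinElem K (t ^ 4)) t⁻¹) 2)
    convert this using 1
    field_simp

lemma isAlgebraic_of_forall_isValuativeIn {K : Subring F}
    (h : ∀ S : Subring F, K < S → IsValuativeIn S) (x : F) : IsAlgebraic K x := by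
  by_contra hx
  refine not_isValuativeIn_of_transcendental hx (h _ (lt_of_le_of_ne (le_adjoinElem _ _) ?_))
  intro he
  have h4 : x ^ 4 ∈ K := by
    rw [he]
    exact mem_adjoinElem K (x ^ 4)
  have : IsAlgebraic K (x ^ 4) := isAlgebraic_algebraMap (⟨x ^ 4, h4⟩ : K)
  exact hx (this.of_pow (by norm_num))

/-- The inverse of an element algebraic over the field `K` is a polynomial in that element. -/
lemma inv_mem_of_isIntegral {K S : Subring F} (hKS : K ≤ S) (hK : ∀ x ∈ K, x⁻¹ ∈ K)
    {x : F} (hx : IsIntegral K x) (hxS : x ∈ S) : x⁻¹ ∈ S := by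
  let k : Subfield F := { K with inv_mem' := hK }
  have hxk : IsIntegral k x := hx
  let S' : Subalgebra k F := { S with algebraMap_mem' := fun r => hKS r.2 }
  exact S'.inv_mem_of_algebraic (x := ⟨x, hxS⟩) hxk.isAlgebraic

lemma isValuativeIn_iff_of_forall_isIntegral {K S : Subring F} (hKS : K ≤ S)
    (hK : ∀ x ∈ K, x⁻¹ ∈ K) (hF : ∀ x : F, IsIntegral K x) :
    IsValuativeIn S ↔ S = ⊤ ∨ IsPointwiseMinimalExt S ⊤ := by
  have hinv : ∀ x : F, adjoinElem S x⁻¹ ≤ adjoinElem S x := fun x =>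
    adjoinElem_le_iff.2 ⟨le_adjoinElem _ _, inv_mem_of_isIntegral
      (hKS.trans (le_adjoinElem _ _)) hK (hF x) (mem_adjoinElem _ _)⟩
  have heq : ∀ x : F, adjoinElem S x⁻¹ = adjoinElem S x := fun x =>
    (hinv x).antisymm (by simpa using hinv x⁻¹)
  simp only [IsValuativeIn, heq, or_self]
  constructor
  · intro h
    refine or_iff_not_imp_left.2 fun hS => ⟨lt_top_iff_ne_top.2 hS, fun x _ hx => ?_⟩
    refine (h x).covBy_of_ne fun he => hx ?_
    rw [he]
    exact mem_adjoinElem S x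
  · rintro (rfl | h) x
    · exact wcovBy_adjoinElem_of_mem (Subring.mem_top x)
    · by_cases hx : x ∈ S
      · exact wcovBy_adjoinElem_of_mem hx
      · exact (h.2 x (Subring.mem_top x) hx).wcovBy

end Field

/-! ### Passing to the residue field of `V` -/

section Residue

variable {Q : Type*} [Field Q] {V : ValuationSubring Q}

lemma mem_residueSubring {A : Subring Q} {y : ResidueField V} :
    y ∈ residueSubring V A ↔ ∃ v : V, (v : Q) ∈ A ∧ residue V v = y := by
  simp only [residueSubring, Subring.mem_map, Subring.mem_comap]
  rfl

lemma residueSubring_mono {A B : Subring Q} (h : A ≤ B) :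
    residueSubring V A ≤ residueSubring V B := fun _ hy => by
  obtain ⟨v, hv, rfl⟩ := mem_residueSubring.1 hy
  exact mem_residueSubring.2 ⟨v, h hv, rfl⟩

/-- The preimage in `V` of a subring of the residue field, as a subring of `Q`. -/
def liftSubring (V : ValuationSubring Q) (k : Subring (ResidueField V)) : Subring Q :=
  (k.comap (residue V)).map V.subtype

lemma coe_mem_liftSubring {k : Subring (ResidueField V)} {v : V} :
    (v : Q) ∈ liftSubring V k ↔ residue V v ∈ k := by
  simp only [liftSubring, Subring.mem_map, Subring.mem_comap]
  constructor
  · rintro ⟨w, hw, h⟩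
    rwa [← Subtype.ext (a1 := w) h]
  · exact fun h => ⟨v, h, rfl⟩

lemma liftSubring_le (k : Subring (ResidueField V)) : liftSubring V k ≤ V.toSubring := by
  rintro _ ⟨w, _, rfl⟩
  exact w.2

lemma residueSubring_liftSubring (k : Subring (ResidueField V)) :
    residueSubring V (liftSubring V k) = k := by
  ext y
  rw [mem_residueSubring]
  constructor
  · rintro ⟨v, hv, rfl⟩
    exact coe_mem_liftSubring.1 hv
  · intro hy
    obtain ⟨v, rfl⟩ := residue_surjective y
    exact ⟨v, coe_mem_liftSubring.2 hy, rfl⟩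

/-- `A` contains the maximal ideal of `V`. -/
def ContainsMaximalIdeal (V : ValuationSubring Q) (A : Subring Q) : Prop :=
  ∀ v : V, residue V v = 0 → (v : Q) ∈ A

lemma ContainsMaximalIdeal.mono {A B : Subring Q} (hA : ContainsMaximalIdeal V A) (h : A ≤ B) :
    ContainsMaximalIdeal V B :=
  fun v hv => h (hA v hv)

/-- Two lifts of a residue differ by an element of `M ⊆ A`. -/
lemma ContainsMaximalIdeal.residue_mem {A : Subring Q} (hA : ContainsMaximalIdeal V A) {v : V} :
    residue V v ∈ residueSubring V A ↔ (v : Q) ∈ A := by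
  rw [mem_residueSubring]
  constructor
  · rintro ⟨w, hw, h⟩
    have := A.add_mem hw (hA (v - w) (by rw [map_sub, h, sub_self]))
    simpa using this
  · exact fun h => ⟨v, h, rfl⟩

lemma residueSubring_le_iff {A B : Subring Q} (hAV : A ≤ V.toSubring)
    (hB : ContainsMaximalIdeal V B) :
    residueSubring V A ≤ residueSubring V B ↔ A ≤ B := by
  refine ⟨fun h y hy => ?_, residueSubring_mono⟩
  exact hB.residue_mem (v := ⟨y, hAV hy⟩).1 (h (mem_residueSubring.2 ⟨_, hy, rfl⟩))

lemma residueSubring_lt_iff {A B : Subring Q} (hAV : A ≤ V.toSubring) (hBV : B ≤ V.toSubring)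
    (hA : ContainsMaximalIdeal V A) (hB : ContainsMaximalIdeal V B) :
    residueSubring V A < residueSubring V B ↔ A < B := by
  rw [lt_iff_le_not_ge, lt_iff_le_not_ge, residueSubring_le_iff hAV hB,
    residueSubring_le_iff hBV hA]

lemma residueSubring_inj {A B : Subring Q} (hAV : A ≤ V.toSubring) (hBV : B ≤ V.toSubring)
    (hA : ContainsMaximalIdeal V A) (hB : ContainsMaximalIdeal V B) :
    residueSubring V A = residueSubring V B ↔ A = B := by
  rw [le_antisymm_iff, le_antisymm_iff, residueSubring_le_iff hAV hB,
    residueSubring_le_iff hBV hA]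

lemma containsMaximalIdeal_liftSubring (k : Subring (ResidueField V)) :
    ContainsMaximalIdeal V (liftSubring V k) := fun v hv =>
  coe_mem_liftSubring.2 (by rw [hv]; exact k.zero_mem)

lemma containsMaximalIdeal_toSubring : ContainsMaximalIdeal V V.toSubring :=
  fun v _ => v.2

lemma residueSubring_toSubring : residueSubring V V.toSubring = ⊤ := by
  refine eq_top_iff.2 fun y _ => ?_
  obtain ⟨v, rfl⟩ := residue_surjective y
  exact mem_residueSubring.2 ⟨v, v.2, rfl⟩

lemma residueSubring_wcovBy_iff {A B : Subring Q} (hAV : A ≤ V.toSubring)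
    (hBV : B ≤ V.toSubring) (hA : ContainsMaximalIdeal V A) (hB : ContainsMaximalIdeal V B) :
    residueSubring V A ⩿ residueSubring V B ↔ A ⩿ B := by
  rw [WCovBy, WCovBy, residueSubring_le_iff hAV hB]
  refine and_congr_right fun _ => ⟨fun h C hAC hCB => ?_, fun h k hAk hkB => ?_⟩
  · have hC := hA.mono hAC.le
    have hCV := hCB.le.trans hBV
    exact h ((residueSubring_lt_iff hAV hCV hA hC).2 hAC)
      ((residueSubring_lt_iff hCV hBV hC hB).2 hCB)
  · rw [← residueSubring_liftSubring k] at hAk hkB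
    exact h ((residueSubring_lt_iff hAV (liftSubring_le k) hA
      (containsMaximalIdeal_liftSubring k)).1 hAk) ((residueSubring_lt_iff (liftSubring_le k) hBV
        (containsMaximalIdeal_liftSubring k) hB).1 hkB)

lemma residueSubring_covBy_iff {A B : Subring Q} (hAV : A ≤ V.toSubring)
    (hBV : B ≤ V.toSubring) (hA : ContainsMaximalIdeal V A) (hB : ContainsMaximalIdeal V B) :
    residueSubring V A ⋖ residueSubring V B ↔ A ⋖ B := by
  rw [covBy_iff_wcovBy_and_lt, covBy_iff_wcovBy_and_lt, residueSubring_wcovBy_iff hAV hBV hA hB,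
    residueSubring_lt_iff hAV hBV hA hB]

lemma adjoinElem_le_toSubring {A : Subring Q} (hAV : A ≤ V.toSubring) (v : V) :
    adjoinElem A (v : Q) ≤ V.toSubring :=
  adjoinElem_le_iff.2 ⟨hAV, v.2⟩

lemma residueSubring_adjoinElem {A : Subring Q} (hAV : A ≤ V.toSubring) (v : V) :
    residueSubring V (adjoinElem A (v : Q)) =
      adjoinElem (residueSubring V A) (residue V v) := by
  apply le_antisymm
  · rw [← residueSubring_liftSubring (adjoinElem (residueSubring V A) (residue V v))]
    refine residueSubring_mono (adjoinElem_le_iff.2 ⟨fun y hy => ?_, ?_⟩)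
    · exact coe_mem_liftSubring (v := ⟨y, hAV hy⟩).2
        (le_adjoinElem _ _ (mem_residueSubring.2 ⟨_, hy, rfl⟩))
    · exact coe_mem_liftSubring.2 (mem_adjoinElem _ _)
  · exact adjoinElem_le_iff.2 ⟨residueSubring_mono (le_adjoinElem _ _),
      mem_residueSubring.2 ⟨v, mem_adjoinElem _ _, rfl⟩⟩

lemma wcovBy_adjoinElem_residue_iff {A : Subring Q} (hAV : A ≤ V.toSubring)
    (hA : ContainsMaximalIdeal V A) (v : V) :
    residueSubring V A ⩿ adjoinElem (residueSubring V A) (residue V v) ↔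
      A ⩿ adjoinElem A (v : Q) := by
  rw [← residueSubring_adjoinElem hAV, residueSubring_wcovBy_iff hAV
    (adjoinElem_le_toSubring hAV v) hA (hA.mono (le_adjoinElem _ _))]

lemma isPointwiseMinimalExt_residueSubring_iff {A B : Subring Q} (hAV : A ≤ V.toSubring)
    (hBV : B ≤ V.toSubring) (hA : ContainsMaximalIdeal V A) (hB : ContainsMaximalIdeal V B) :
    IsPointwiseMinimalExt (residueSubring V A) (residueSubring V B) ↔
      IsPointwiseMinimalExt A B := by
  rw [IsPointwiseMinimalExt, IsPointwiseMinimalExt, residueSubring_lt_iff hAV hBV hA hB]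
  refine and_congr_right fun _ => ?_
  have cov : ∀ v : V, residueSubring V A ⋖ adjoinElem (residueSubring V A) (residue V v) ↔
      A ⋖ adjoinElem A (v : Q) := fun v => by
    rw [← residueSubring_adjoinElem hAV, residueSubring_covBy_iff hAV
      (adjoinElem_le_toSubring hAV v) hA (hA.mono (le_adjoinElem _ _))]
  constructor
  · intro h x hxB hxA
    exact (cov ⟨x, hBV hxB⟩).1 (h _ (hB.residue_mem.2 hxB) (mt hA.residue_mem.1 hxA))
  · intro h y hyB hyA
    obtain ⟨v, rfl⟩ := residue_surjective y
    exact (cov v).2 (h _ (hB.residue_mem.1 hyB) (mt hA.residue_mem.2 hyA))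

lemma quotField_eq_top_of_le {R S : Subring Q} [IsFractionRing R Q] (h : R ≤ S) :
    quotField S = ⊤ := by
  refine eq_top_iff.2 fun x _ => ?_
  obtain ⟨a, b, _, rfl⟩ := IsFractionRing.div_surjective (A := R) x
  exact div_mem (Subfield.subset_closure (h a.2)) (Subfield.subset_closure (h b.2))

lemma isValuativeDomain_of_forall_mem_or_inv_mem {A : Subring Q}
    (h : ∀ x : Q, x ∈ A ∨ x⁻¹ ∈ A) : IsValuativeDomain A :=
  fun x _ => (h x).imp wcovBy_adjoinElem_of_mem wcovBy_adjoinElem_of_mem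

lemma ContainsMaximalIdeal.mem_of_inv_notMem {A : Subring Q} (hA : ContainsMaximalIdeal V A)
    {x : Q} (hx : x⁻¹ ∉ V) : x ∈ A := by
  have hxV : x ∈ V := (V.mem_or_inv_mem x).resolve_right hx
  refine hA ⟨x, hxV⟩ ((residue_eq_zero_iff _).2 ((mem_maximalIdeal _).2 fun hu => hx ?_))
  obtain ⟨y, hy⟩ := hu.exists_right_inv
  have h1 : x * (y : Q) = 1 := congrArg Subtype.val hy
  exact (eq_inv_of_mul_eq_one_right h1) ▸ y.2

lemma isValuativeDomain_iff_residueSubring {A : Subring Q} (hq : quotField A = ⊤)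
    (hAV : A ≤ V.toSubring) (hA : ContainsMaximalIdeal V A) :
    IsValuativeDomain A ↔ IsValuativeIn (residueSubring V A) := by
  have inv : ∀ v : V, ∀ h : (v : Q)⁻¹ ∈ V, residue V ⟨(v : Q)⁻¹, h⟩ = (residue V v)⁻¹ := by
    intro v h
    by_cases hv : (v : Q) = 0
    · obtain rfl : v = 0 := Subtype.ext hv
      have : (⟨((0 : V) : Q)⁻¹, h⟩ : V) = 0 := Subtype.ext (by simp)
      rw [this]
      simp
    · refine eq_inv_of_mul_eq_one_left ?_
      rw [← map_mul, ← map_one (residue V)]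
      exact congrArg _ (Subtype.ext (inv_mul_cancel₀ hv))
  constructor
  · intro h y
    obtain ⟨v, rfl⟩ := residue_surjective y
    by_cases hv : (v : Q)⁻¹ ∈ V
    · rw [← inv v hv, wcovBy_adjoinElem_residue_iff hAV hA, wcovBy_adjoinElem_residue_iff hAV hA]
      exact h v (hq ▸ Subfield.mem_top _)
    · exact .inl (wcovBy_adjoinElem_of_mem (hA.residue_mem.2 (hA.mem_of_inv_notMem hv)))
  · intro h x _
    by_cases hx : x ∈ V
    · by_cases hv : x⁻¹ ∈ V
      · have := h (residue V ⟨x, hx⟩)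
        rwa [← inv ⟨x, hx⟩ hv, wcovBy_adjoinElem_residue_iff hAV hA,
          wcovBy_adjoinElem_residue_iff hAV hA] at this
      · exact .inl (wcovBy_adjoinElem_of_mem (hA.mem_of_inv_notMem hv))
    · exact .inr (wcovBy_adjoinElem_of_mem (hA.mem_of_inv_notMem (by rwa [inv_inv])))

/-- A ring containing the maximal ideal of `V` is comparable with `V`. -/
lemma ContainsMaximalIdeal.le_or_ge {A : Subring Q} (hA : ContainsMaximalIdeal V A) :
    A ≤ V.toSubring ∨ V.toSubring ≤ A := by
  refine or_iff_not_imp_left.2 fun h v hv => ?_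
  obtain ⟨x, hxA, hxV⟩ := SetLike.not_le_iff_exists.1 h
  have hx0 : x ≠ 0 := by
    rintro rfl
    exact hxV V.zero_mem
  by_cases hv0 : v = 0
  · exact hv0 ▸ A.zero_mem
  -- If `x / v ∈ V`, then `x = (x / v) v ∈ V`, a contradiction; otherwise `v / x ∈ M ⊆ A` and `v =
  -- (v / x) x ∈ A`.
  by_cases hw : (v * x⁻¹)⁻¹ ∈ V
  · have h1 := V.mul_mem _ _ hw hv
    have h2 : (v * x⁻¹)⁻¹ * v = x := by field_simp
    rw [h2] at h1
    exact absurd h1 hxV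
  · have := A.mul_mem (hA.mem_of_inv_notMem hw) hxA
    rwa [inv_mul_cancel_right₀ hx0] at this

/-- A monic equation over the residue ring lifts to a monic `p` over `R` with `p(v) ∈ M ⊆ R`, so `p
- p(v)` is an equation for `v` over `R`. -/
lemma isIntegral_residue_iff {R : Subring Q} (hRV : R ≤ V.toSubring)
    (hR : ContainsMaximalIdeal V R) (v : V) :
    IsIntegral (residueSubring V R) (residue V v) ↔ IsIntegral R (v : Q) := by
  let f : R →+* residueSubring V R :=
    ((residue V).comp (Subring.inclusion hRV)).codRestrict _
      fun r => mem_residueSubring.2 ⟨_, r.2, rfl⟩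
  have hf : Function.Surjective f := by
    rintro ⟨y, hy⟩
    obtain ⟨w, hw, rfl⟩ := mem_residueSubring.1 hy
    exact ⟨⟨w, hw⟩, rfl⟩
  have ev : ∀ p : R[X], eval₂ (algebraMap R Q) (v : Q) p =
      (eval₂ (Subring.inclusion hRV : R →+* V) v p : V) := fun p => by
    change _ = V.subtype _
    rw [hom_eval₂]
    rfl
  have ev' : ∀ p : R[X], eval₂ (algebraMap (residueSubring V R) (ResidueField V)) (residue V v)
      (p.map f) = residue V (eval₂ (Subring.inclusion hRV : R →+* V) v p) := fun p => by
    rw [hom_eval₂, eval₂_map]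
    rfl
  constructor
  · rintro ⟨q, hq, h0⟩
    obtain ⟨p, hp, hdeg, hmon⟩ := lifts_and_natDegree_eq_and_monic
      ((lifts_iff_coeff_lifts _).2 fun n => hf _ : q ∈ lifts f) hq
    rw [← hp, ev'] at h0
    have hm := hR _ h0
    rw [← ev] at hm
    -- Subtracting a constant preserves monicity only in positive degree; `p = 1` would give `1 = 0`
    -- in the residue field.
    have hdp : 0 < p.natDegree := by
      by_contra hn
      have : p = 1 := hmon.natDegree_eq_zero.1 (by omega)
      rw [this] at h0
      simp at h0
    refine ⟨p - C ⟨_, hm⟩, hmon.sub_of_left ?_, ?_⟩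
    · exact degree_C_le.trans_lt (natDegree_pos_iff_degree_pos.1 hdp)
    · rw [eval₂_sub, eval₂_C]
      exact sub_self _
  · rintro ⟨p, hp, h0⟩
    refine ⟨p.map f, hp.map f, ?_⟩
    rw [ev']
    rw [ev] at h0
    rw [(Subtype.ext h0 : eval₂ (Subring.inclusion hRV : R →+* V) v p = 0), map_zero]

lemma integralClosureIn_le {R : Subring Q} (hRV : R ≤ V.toSubring) :
    integralClosureIn R ≤ V.toSubring := by
  rintro x ⟨p, hp, h0⟩
  have hx : IsIntegral V x := by
    refine ⟨p.map (Subring.inclusion hRV : R →+* V), hp.map _, ?_⟩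
    rw [eval₂_map]
    exact h0
  obtain ⟨y, rfl⟩ := IsIntegrallyClosed.isIntegral_iff.1 hx
  exact y.2

lemma le_integralClosureIn (R : Subring Q) : R ≤ integralClosureIn R :=
  fun x hx => (integralClosure R Q).algebraMap_mem ⟨x, hx⟩

lemma residueSubring_integralClosureIn_eq_top_iff {R : Subring Q} (hRV : R ≤ V.toSubring)
    (hR : ContainsMaximalIdeal V R) :
    residueSubring V (integralClosureIn R) = ⊤ ↔
      ∀ y : ResidueField V, IsIntegral (residueSubring V R) y := by
  rw [eq_top_iff]
  refine ⟨fun h y => ?_, fun h y _ => ?_⟩ <;> obtain ⟨v, rfl⟩ := residue_surjective y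
  · exact (isIntegral_residue_iff hRV hR v).2
      ((hR.mono (le_integralClosureIn R)).residue_mem.1 (h (Subring.mem_top _)))
  · exact mem_residueSubring.2 ⟨v, (isIntegral_residue_iff hRV hR v).1 (h _), rfl⟩

/-! ### Consequences for the associated valuation overring -/

namespace IsAssociatedValuationOverring

variable {R : Subring Q}

lemma containsMaximalIdeal (hV : IsAssociatedValuationOverring R V) :
    ContainsMaximalIdeal V R := by
  intro v hv
  have := hV.isLocalRing
  have h1 : (v : Q) ∈ (Subtype.val '' (maximalIdeal V : Set V) : Set Q) :=
    ⟨v, (residue_eq_zero_iff v).1 hv, rfl⟩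
  rw [← hV.maximalIdeal_eq] at h1
  obtain ⟨r, _, hr⟩ := h1
  exact hr ▸ r.2

lemma inv_mem_residueSubring (hV : IsAssociatedValuationOverring R V) (y : ResidueField V)
    (hy : y ∈ residueSubring V R) : y⁻¹ ∈ residueSubring V R := by
  have := hV.isLocalRing
  obtain ⟨v, hv, rfl⟩ := mem_residueSubring.1 hy
  by_cases hu : IsUnit (⟨v, hv⟩ : R)
  · obtain ⟨w, hw⟩ := hu.exists_left_inv
    refine mem_residueSubring.2 ⟨⟨w, hV.le w.2⟩, w.2, eq_inv_of_mul_eq_one_left ?_⟩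
    rw [← map_mul, ← map_one (residue V)]
    exact congrArg _ (Subtype.ext (congrArg (Subtype.val : R → Q) hw :))
  · have h1 : (v : Q) ∈ (Subtype.val '' (maximalIdeal R : Set R) : Set Q) :=
      ⟨⟨v, hv⟩, (mem_maximalIdeal _).2 hu, rfl⟩
    rw [hV.maximalIdeal_eq] at h1
    obtain ⟨w, hw, hwv⟩ := h1
    rw [← Subtype.ext (a1 := w) hwv, (residue_eq_zero_iff w).2 hw, inv_zero]
    exact Subring.zero_mem _

lemma isMaximalNonValuativeDomain_iff [IsFractionRing R Q]
    (hV : IsAssociatedValuationOverring R V) :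
    IsMaximalNonValuativeDomain R ↔ IsMaximalNonValuativeSubring R V.toSubring := by
  have hval : ∀ A : Subring Q, V.toSubring ≤ A → IsValuativeDomain A := fun A hA =>
    isValuativeDomain_of_forall_mem_or_inv_mem fun x =>
      (V.mem_or_inv_mem x).imp (fun h => hA h) (fun h => hA h)
  rw [IsMaximalNonValuativeDomain, quotField_eq_top_of_le (le_refl R)]
  constructor
  · rintro ⟨_, hn, h⟩
    exact ⟨lt_of_le_of_ne hV.le fun he => hn (hval R he.ge), hn,
      fun S hRS _ => h S hRS fun _ _ => Subfield.mem_top _⟩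
  · rintro ⟨hlt, hn, h⟩
    refine ⟨lt_of_lt_of_le hlt fun _ _ => Subfield.mem_top _, hn, fun S hRS _ => ?_⟩
    exact (hV.containsMaximalIdeal.mono hRS.le).le_or_ge.elim (h S hRS) (hval S)

lemma isMaximalNonValuativeSubring_iff [IsFractionRing R Q]
    (hV : IsAssociatedValuationOverring R V) :
    IsMaximalNonValuativeSubring R V.toSubring ↔
      residueSubring V R < ⊤ ∧ ¬ IsValuativeIn (residueSubring V R) ∧
        ∀ S : Subring (ResidueField V), residueSubring V R < S → IsValuativeIn S := by
  have hM := hV.containsMaximalIdeal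
  rw [IsMaximalNonValuativeSubring, ← residueSubring_toSubring,
    residueSubring_lt_iff hV.le le_rfl hM containsMaximalIdeal_toSubring,
    isValuativeDomain_iff_residueSubring (quotField_eq_top_of_le (le_refl R)) hV.le hM]
  refine and_congr_right fun _ => and_congr_right fun _ => ⟨fun h k hk => ?_, fun h S hRS hSV => ?_⟩
  · rw [← residueSubring_liftSubring k,
      residueSubring_lt_iff hV.le (liftSubring_le k) hM (containsMaximalIdeal_liftSubring k)] at hk
    have := h _ hk (liftSubring_le k)
    rwa [isValuativeDomain_iff_residueSubring (quotField_eq_top_of_le hk.le) (liftSubring_le k)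
      (containsMaximalIdeal_liftSubring k), residueSubring_liftSubring] at this
  · have hS := hM.mono hRS.le
    rw [isValuativeDomain_iff_residueSubring (quotField_eq_top_of_le hRS.le) hSV hS]
    exact h _ ((residueSubring_lt_iff hV.le hSV hM hS).2 hRS)

end IsAssociatedValuationOverring

end Residue

theorem theorem2p12 {Q : Type*} [Field Q] (R : Subring Q) [IsFractionRing R Q]
    (hR : IsPseudoValuationDomain R) (V : ValuationSubring Q)
    (hV : IsAssociatedValuationOverring R V)
    (R' : Subring Q) (hR' : R' = integralClosureIn R)
    (K L : Subring (IsLocalRing.ResidueField V))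
    (hK : K = residueSubring V R) (hL : L = residueSubring V R') :
    List.TFAE [
      IsMaximalNonValuativeSubring R V.toSubring,
      IsMaximalNonValuativeDomain R,
      R' = V.toSubring ∧ (R < R' ∧ ¬ IsPointwiseMinimalExt R R') ∧
        ∀ S : Subring Q, R < S → S ≤ R' → S = R' ∨ IsPointwiseMinimalExt S R',
      L = ⊤ ∧ (K < L ∧ ¬ IsPointwiseMinimalExt K L) ∧
        ∀ S : Subring (IsLocalRing.ResidueField V), K < S → S ≤ L →
          S = L ∨ IsPointwiseMinimalExt S L] := by
  have hM := hV.containsMaximalIdeal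
  have hRR' : R ≤ R' := hR' ▸ le_integralClosureIn R
  have hR'V : R' ≤ V.toSubring := hR' ▸ integralClosureIn_le hV.le
  have hM' := hM.mono hRR'
  have hLtop : L = ⊤ ↔ ∀ y : ResidueField V, IsIntegral K y := by
    rw [hL, hR', hK, residueSubring_integralClosureIn_eq_top_iff hV.le hM]
  have hKinv : ∀ y ∈ K, y⁻¹ ∈ K := hK ▸ hV.inv_mem_residueSubring
  tfae_have 2 ↔ 1 := hV.isMaximalNonValuativeDomain_iff
  tfae_have 3 ↔ 4 := by
    subst hK hL
    rw [← residueSubring_toSubring,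
      residueSubring_inj hR'V le_rfl hM' containsMaximalIdeal_toSubring,
      residueSubring_lt_iff hV.le hR'V hM hM',
      isPointwiseMinimalExt_residueSubring_iff hV.le hR'V hM hM']
    refine and_congr_right fun _ => and_congr_right fun _ =>
      ⟨fun h k hk hkL => ?_, fun h S hRS hSR' => ?_⟩
    · have hkM := containsMaximalIdeal_liftSubring k
      have hkV := liftSubring_le k
      rw [← residueSubring_liftSubring k] at hk hkL ⊢
      rw [residueSubring_inj hkV hR'V hkM hM',
        isPointwiseMinimalExt_residueSubring_iff hkV hR'V hkM hM']
      exact h _ ((residueSubring_lt_iff hV.le hkV hM hkM).1 hk)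
        ((residueSubring_le_iff hkV hM').1 hkL)
    · have hS := hM.mono hRS.le
      have hSV := hSR'.trans hR'V
      rw [← residueSubring_inj hSV hR'V hS hM',
        ← isPointwiseMinimalExt_residueSubring_iff hSV hR'V hS hM']
      exact h _ ((residueSubring_lt_iff hV.le hSV hM hS).2 hRS) (residueSubring_mono hSR')
  tfae_have 1 ↔ 4 := by
    rw [hV.isMaximalNonValuativeSubring_iff, ← hK]
    constructor
    · rintro ⟨hlt, hn, h⟩
      have hint : ∀ y : ResidueField V, IsIntegral K y := fun y => by
        -- Over a field, algebraic elements are integral.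
        let k : Subfield (ResidueField V) := { K with inv_mem' := hKinv }
        exact (isAlgebraic_iff_isIntegral (K := k)).1 (isAlgebraic_of_forall_isValuativeIn h y)
      have htop := hLtop.2 hint
      rw [isValuativeIn_iff_of_forall_isIntegral le_rfl hKinv hint] at hn
      rw [htop]
      exact ⟨rfl, ⟨hlt, fun hp => hn (.inr hp)⟩, fun S hKS _ =>
        (isValuativeIn_iff_of_forall_isIntegral hKS.le hKinv hint).1 (h S hKS)⟩
    · rintro ⟨htop, ⟨hlt, hn⟩, h⟩
      have hint := hLtop.1 htop
      rw [htop] at hlt hn h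
      refine ⟨hlt, ?_, fun S hKS => ?_⟩
      · rw [isValuativeIn_iff_of_forall_isIntegral le_rfl hKinv hint]
        exact fun hv => hv.elim hlt.ne hn
      · exact (isValuativeIn_iff_of_forall_isIntegral hKS.le hKinv hint).2 (h S hKS le_top)
  tfae_finish
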